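/- **Setting.** Consider a typed first-order language whose types are the basic types (integers, booleans) and algebraic data types (ADTs) freely generated by typed constructors. A *constraint* is a quantifier-free formula of linear integer arithmetic and booleans, where equations between terms of ADT type are also admitted. An *atom* is $p(t_1,\dots,t_m)$ with $p$ a typed predicate symbol and $t_j$ typed terms. A *constrained Horn clause* (clause) is $H\leftarrow c,B$ with $c$ a constraint, $B$ a finite conjunction of atoms (order is immaterial), and $H$ an atom (*definite* clause) or $\mathit{false}$ (*goal*); its variables are universally quantified and may be freely renamed (a *variant* is a renaming). $\mathbb D$ is the usual interpretation of integers, booleans and ADTs; an interpretation extends $\mathbb D$ by a relation for each predicate symbol. A set of clauses is *satisfiable* if some interpretation makes all its clauses true. $\mathit{Definite}(P)$ is the set of definite clauses of $P$; for a set $P$ of definite clauses $M(P)$ is its least model. For an expression $e$, $\mathit{vars}(e)$ is its set of variables; $\mathit{bvars}$ and $\mathit{adt\text{-}vars}$ denote the variables of basic type and of ADT type. $F(X,Y)$ denotes a nonempty conjunction of atoms with $\mathit{vars}(F)=X\cup Y$, $X\cap Y=\emptyset$. It is *functional* (from $X$ to $Y$) w.r.t. $P$ if $M(P)\models\forall X,Y,Z.\,F(X,Y)\wedge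 F(X,Z)\to Y=Z$, and *total* w.r.t. $P$ if $M(P)\models\forall X\exists Y.\,F(X,Y)$; $F(X;Y)$ means both. Let $\ell$ map predicate symbols to $\mathbb N$; the level of an atom is that of its predicate, and $\mathit{false}$ counts as lying above all levels. A *transformation sequence* $P_0\Rightarrow\dots\Rightarrow P_n$ is a sequence of sets of clauses, such that in every clause of $P_0$ the level of the head is at least that of each body atom, and each $P_{i+1}$ is obtained from $P_i$ by one of the rules below. $\mathit{Defs}_i$ is the set of clauses introduced by R1 in the first $i$ steps, and $\mathcal P_i=\mathit{Definite}(P_0)\cup\mathit{Defs}_i$. In R2–R7, $C$ is a clause of $P_i$ (up to variants). * **R1 (definition).** $P_{i+1}=P_i\cup\{D\}$, $D$: $\mathit{newp}(X_1,\dots,X_k)\leftarrow c,A_1,\dots,A_m$, where $\mathit{newp}$ does not occur in $P_0,\dots,P_i$, the predicates of the $A_j$ occur in $P_0$, the $X_j$ are variables in $\mathit{vars}(\{c,A_1,\dots,A_m\})$, and $\ell(\mathit{newp})=\max_j\ell(A_j)$ ($0$ if $m=0$). * **R2 (unfolding).** $C$: $H\leftarrow c,A,G$ with $A$ an atom. $P_{i+1}=(P_i\setminus\{C\})\cup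 U$, where $U$ consists of the clauses $(H\leftarrow c,c_j,G,B_j)\vartheta_j$, one for each definite clause of $P_0$ whose variant $K_j\leftarrow c_j,B_j$ (with no variable in common with $C$) is such that $A$ and $K_j$ have a most general unifier $\vartheta_j$ and $(c,c_j)\vartheta_j$ is satisfiable. * **R3 (folding).** $C$: $H\leftarrow c,G,Q$; $D$: $K\leftarrow d,B$ is a variant of a clause in $\mathit{Defs}_i$; $H$ is $\mathit{false}$ or $\ell(H)\ge\ell(K)$; $\vartheta$ is a substitution with $Q=B\vartheta$ and $\mathbb D\models\forall(c\to d\vartheta)$. $P_{i+1}=(P_i\setminus\{C\})\cup\{H\leftarrow c,G,K\vartheta\}$. * **R4 (clause deletion).** $P_{i+1}=P_i\setminus\{C\}$, where the constraint of $C$ is unsatisfiable. * **R5 (functionality).** $C$: $H\leftarrow c,G,F(X,Y),F(X,Z)$, where $F(X,Y)$ is functional w.r.t. $\mathcal P_i$ and $F(X,Z)$ is obtained by replacing the tuple $Y$ by a tuple $Z$ of distinct variables not in $X$. $P_{i+1}=(P_i\setminus\{C\})\cup\{H\leftarrow c,Y=Z,G,F(X,Y)\}$. * **R6 (totality).** $C$: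 $H\leftarrow c,G,F(X,Y)$, where $F(X,Y)$ is total w.r.t. $\mathcal P_i$ and $Y\cap\mathit{vars}(H\leftarrow c,G)=\emptyset$. $P_{i+1}=(P_i\setminus\{C\})\cup\{H\leftarrow c,G\}$. * **R7 (differential replacement).** $C$: $H\leftarrow c,G,F(X;Y)$; $D$: $\mathit{diff}(Z)\leftarrow d,F(X;Y),R(V;W)$ is a variant of a clause in $\mathit{Defs}_i$; $F(X;Y)$, $R(V;W)$ are total and functional w.r.t. $\mathcal P_i$; $W\cap\mathit{vars}(C)=\emptyset$; $\mathbb D\models\forall(c\to d)$; $H$ is $\mathit{false}$ or $\ell(H)>\ell(\mathit{diff})$. $P_{i+1}=(P_i\setminus\{C\})\cup\{H\leftarrow c,G,R(V;W),\mathit{diff}(Z)\}$. **Theorem (Completeness of the transformation rules).** Let $P_0\Rightarrow P_1\Rightarrow\dots\Rightarrow P_n$ be a transformation sequence using rules R1–R7. Suppose that every application of R3 satisfies (E) for every $X\in\mathit{vars}(\{d,B\})\setminus\mathit{vars}(K)$: $X\vartheta$ is a variable that does not occur in $\{H,c,G\}$ and does not occur in $Y\vartheta$ for any variable $Y\ne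 X$ of $(d,B)$; and that every application of R7 satisfies (F) $\mathit{diff}(Z)$ has the form $\mathit{diff}(T_b,W_b,Y_b)$ with $T_b=\mathit{bvars}(X\cup V)$, $W_b=\mathit{bvars}(W)$, $Y_b=\mathit{bvars}(Y)$, and: (F1) $\mathit{diff}(T_b,W_b,Y_b)$ is functional from $(T_b,W_b)$ to $Y_b$ w.r.t. $\mathit{Definite}(P_0)\cup\mathit{Defs}_i$; (F2) $Y\cap(V\cup\mathit{vars}(d))=\emptyset$; (F3) $\mathit{adt\text{-}vars}(Y)\cap\mathit{adt\text{-}vars}(\{H,c,G\})=\emptyset$. If $P_0$ is satisfiable, then $P_n$ is satisfiable. -/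

import Mathlib

/-! ### The typed language: linear integer arithmetic, booleans and algebraic data types -/

/-- The types: the two basic types and the algebraic data types (ADTs), whose names are in `A`. -/
inductive Srt (A : Type*) where
  | int
  | bool
  | adt (a : A)

/-- A type is basic if it is the integer or the boolean type. -/
def Srt.IsBasic {A : Type*} : Srt A → Prop
  | .int => True
  | .bool => True
  | .adt _ => False

/-- The symbols besides those of LIA and Bool: names of ADTs, their typed constructors, and the
typed predicate symbols. -/
structure Signature where
  ADT : Type*
  Con : Type*
  conArity : Con → ℕ
  conArg : (k : Con) → Fin (conArity k) → Srt ADT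
  conRes : Con → ADT
  Pred : Type*
  predArity : Pred → ℕ
  predArg : (p : Pred) → Fin (predArity p) → Srt ADT

namespace Signature

variable {S : Signature}

/-- The types of the language. -/
abbrev Ty (S : Signature) := Srt S.ADT

/-- Typed individual variables: infinitely many names for each type. -/
abbrev Var (S : Signature) := S.Ty × ℕ

/-- Typed terms over the symbols of LIA, Bool and the constructors. -/
inductive Term (S : Signature) : S.Ty → Type _
  | var (s : S.Ty) (n : ℕ) : Term S s
  | intConst (z : ℤ) : Term S .int
  | add (t u : Term S .int) : Term S .int
  | smul (z : ℤ) (t : Term S .int) : Term S .int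
  | boolConst (b : Bool) : Term S .bool
  | con (k : S.Con) (args : (i : Fin (S.conArity k)) → Term S (S.conArg k i)) :
      Term S (.adt (S.conRes k))

/-- The values over which the variables range: integers, booleans, and, for the ADTs, the
finite trees freely generated by the constructors over integers and booleans. -/
inductive Val (S : Signature) : S.Ty → Type _
  | int (z : ℤ) : Val S .int
  | bool (b : Bool) : Val S .bool
  | con (k : S.Con) (args : (i : Fin (S.conArity k)) → Val S (S.conArg k i)) :
      Val S (.adt (S.conRes k))

def Val.toInt : Val S .int → ℤ
  | .int z => z

def Val.toBool : Val S .bool → Bool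
  | .bool b => b

/-- Assignments of values to the variables, respecting types. -/
abbrev Assignment (S : Signature) := (s : S.Ty) → ℕ → S.Val s

/-- Substitutions of terms for variables, respecting types. -/
abbrev Subst (S : Signature) := (s : S.Ty) → ℕ → S.Term s

/-- The substitution given by a type-respecting map from variables to variables. -/
def varSubst (ρ : S.Ty → ℕ → ℕ) : S.Subst := fun s n => .var s (ρ s n)

namespace Term

def vars {s : S.Ty} : S.Term s → Set S.Var
  | var s n => {(s, n)}
  | intConst _ => ∅
  | add t u => t.vars ∪ u.vars
  | smul _ t => t.vars
  | boolConst _ => ∅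
  | con _ args => ⋃ i, (args i).vars

def subst (θ : S.Subst) {s : S.Ty} : S.Term s → S.Term s
  | var s n => θ s n
  | intConst z => intConst z
  | add t u => add (t.subst θ) (u.subst θ)
  | smul z t => smul z (t.subst θ)
  | boolConst b => boolConst b
  | con k args => con k fun i => (args i).subst θ

def eval (σ : S.Assignment) {s : S.Ty} : S.Term s → S.Val s
  | var s n => σ s n
  | intConst z => .int z
  | add t u => .int ((t.eval σ).toInt + (u.eval σ).toInt)
  | smul z t => .int (z * (t.eval σ).toInt)
  | boolConst b => .bool b
  | con k args => .con k fun i => (args i).eval σ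

end Term

/-! ### Constraints, atoms, clauses -/

/-- Constraints: quantifier-free formulas of LIA and Bool. Equations are allowed between any two
terms of the same type, because the functionality rule adds equations `Y = Z` between variables
that may be of ADT type. -/
inductive Constraint (S : Signature)
  | tru : Constraint S
  | eq {s : S.Ty} (t u : S.Term s) : Constraint S
  | le (t u : S.Term .int) : Constraint S
  | isTrue (t : S.Term .bool) : Constraint S
  | not (c : Constraint S) : Constraint S
  | and (c d : Constraint S) : Constraint S
  | or (c d : Constraint S) : Constraint S

namespace Constraint

def vars : S.Constraint → Set S.Var
  | tru => ∅
  | eq t u => t.vars ∪ u.vars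
  | le t u => t.vars ∪ u.vars
  | isTrue t => t.vars
  | not c => c.vars
  | and c d => c.vars ∪ d.vars
  | or c d => c.vars ∪ d.vars

def subst (θ : S.Subst) : S.Constraint → S.Constraint
  | tru => tru
  | eq t u => eq (t.subst θ) (u.subst θ)
  | le t u => le (t.subst θ) (u.subst θ)
  | isTrue t => isTrue (t.subst θ)
  | not c => not (c.subst θ)
  | and c d => and (c.subst θ) (d.subst θ)
  | or c d => or (c.subst θ) (d.subst θ)

/-- Truth in the usual interpretation. -/
def Holds (σ : S.Assignment) : S.Constraint → Prop
  | tru => True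
  | eq t u => t.eval σ = u.eval σ
  | le t u => (t.eval σ).toInt ≤ (u.eval σ).toInt
  | isTrue t => (t.eval σ).toBool = true
  | not c => ¬ c.Holds σ
  | and c d => c.Holds σ ∧ d.Holds σ
  | or c d => c.Holds σ ∨ d.Holds σ

def Satisfiable (c : S.Constraint) : Prop := ∃ σ : S.Assignment, c.Holds σ

/-- `∀ (c → d)` is true in the usual interpretation. -/
def Entails (c d : S.Constraint) : Prop := ∀ σ : S.Assignment, c.Holds σ → d.Holds σ

end Constraint

/-- Atoms `p(t₁,…,tₘ)`. -/
structure Atom (S : Signature) where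
  pred : S.Pred
  args : (i : Fin (S.predArity pred)) → S.Term (S.predArg pred i)

/-- Interpretations agreeing with the usual one on LIA, Bool and the ADTs: a relation for every
predicate symbol, i.e. a set of ground atoms. -/
abbrev Interp (S : Signature) :=
  (p : S.Pred) → ((i : Fin (S.predArity p)) → S.Val (S.predArg p i)) → Prop

namespace Atom

def vars (A : S.Atom) : Set S.Var := ⋃ i, (A.args i).vars

def subst (θ : S.Subst) (A : S.Atom) : S.Atom := ⟨A.pred, fun i => (A.args i).subst θ⟩

def Holds (I : S.Interp) (σ : S.Assignment) (A : S.Atom) : Prop :=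
  I A.pred fun i => (A.args i).eval σ

/-- `θ` is a most general unifier of `A` and `B`. -/
def IsMGU (θ : S.Subst) (A B : S.Atom) : Prop :=
  A.subst θ = B.subst θ ∧
    ∀ η : S.Subst, A.subst η = B.subst η → ∃ δ : S.Subst, ∀ s n, η s n = (θ s n).subst δ

end Atom

/-- Conjunctions of atoms, up to reordering. -/
abbrev Conj (S : Signature) := Multiset S.Atom

namespace Conj

def vars (F : S.Conj) : Set S.Var := {v | ∃ A ∈ F, v ∈ A.vars}

def subst (θ : S.Subst) (F : S.Conj) : S.Conj := F.map (Atom.subst θ)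

def Holds (I : S.Interp) (σ : S.Assignment) (F : S.Conj) : Prop := ∀ A ∈ F, A.Holds I σ

end Conj

/-- The set of variables of a clause head; `none` stands for `false`. -/
def headVars (H : Option S.Atom) : Set S.Var := {v | ∃ A ∈ H, v ∈ A.vars}

/-- Constrained Horn clauses `H ← c, B`; the head `none` stands for `false`. -/
structure Clause (S : Signature) where
  head : Option S.Atom
  con : S.Constraint
  body : S.Conj

namespace Clause

def vars (C : S.Clause) : Set S.Var := headVars C.head ∪ C.con.vars ∪ C.body.vars

def subst (θ : S.Subst) (C : S.Clause) : S.Clause :=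
  ⟨C.head.map (Atom.subst θ), C.con.subst θ, C.body.subst θ⟩

/-- `C` is obtained from `D` by a (bijective) renaming of variables. The order of the atoms in
the body is immaterial since bodies are multisets. -/
def IsVariant (C D : S.Clause) : Prop :=
  ∃ ρ : S.Ty → Equiv.Perm ℕ, C = D.subst (varSubst fun s => ρ s)

/-- The universal closure of the clause is true in `I`. -/
def IsTrueIn (I : S.Interp) (C : S.Clause) : Prop :=
  ∀ σ : S.Assignment, C.con.Holds σ → C.body.Holds I σ → ∃ A ∈ C.head, A.Holds I σ

/-- The predicate symbol `p` occurs in `C`. -/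
def Occurs (p : S.Pred) (C : S.Clause) : Prop :=
  (∃ A ∈ C.head, A.pred = p) ∨ ∃ A ∈ C.body, A.pred = p

/-- The level of the head (`false` lying above every level) is at least that of every atom in
the body. -/
def Stratified (ℓ : S.Pred → ℕ) (C : S.Clause) : Prop :=
  ∀ H ∈ C.head, ∀ A ∈ C.body, ℓ A.pred ≤ ℓ H.pred

end Clause

/-- The predicate symbol `p` occurs in the set `P` of clauses. -/
def OccursIn (p : S.Pred) (P : Set S.Clause) : Prop := ∃ C ∈ P, C.Occurs p

def IsModel (I : S.Interp) (P : Set S.Clause) : Prop := ∀ C ∈ P, C.IsTrueIn I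

def Satisfiable (P : Set S.Clause) : Prop := ∃ I : S.Interp, IsModel I P

/-- The definite clauses of `P`. -/
def definite (P : Set S.Clause) : Set S.Clause := {C ∈ P | C.head ≠ none}

/-- The set of the ground atoms true in all models of `P`: the least model of `P` when `P` is a
set of definite clauses. -/
def leastModel (P : Set S.Clause) : S.Interp := fun p a => ∀ I : S.Interp, IsModel I P → I p a

/-- The variables of basic type, and those of ADT type, in a set of variables. -/
def bvars (X : Set S.Var) : Set S.Var := {v ∈ X | v.1.IsBasic}

def adtVars (X : Set S.Var) : Set S.Var := {v ∈ X | ¬ v.1.IsBasic}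

/-- `σ` and `τ` agree on the variables in `X`. -/
def AgreeOn (X : Set S.Var) (σ τ : S.Assignment) : Prop := ∀ v ∈ X, σ v.1 v.2 = τ v.1 v.2

/-- The notation `F(X,Y)`: a nonempty conjunction whose variables are split into the disjoint
`X` and `Y`. -/
def IsSplit (F : S.Conj) (X Y : Set S.Var) : Prop := F ≠ 0 ∧ Disjoint X Y ∧ F.vars = X ∪ Y

/-- `F(X,Y)` is functional from `X` to `Y` with respect to `P`:
`M(P) ⊨ ∀ X,Y,Z. F(X,Y) ∧ F(X,Z) → Y = Z`. Here `σ` gives the values of `X,Y`, and `τ` those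
of `X,Z`. -/
def Functional (P : Set S.Clause) (F : S.Conj) (X Y : Set S.Var) : Prop :=
  IsSplit F X Y ∧ ∀ σ τ : S.Assignment, AgreeOn X σ τ →
    F.Holds (leastModel P) σ → F.Holds (leastModel P) τ → AgreeOn Y σ τ

/-- `F(X,Y)` is total from `X` to `Y` with respect to `P`: `M(P) ⊨ ∀ X ∃ Y. F(X,Y)`. -/
def Total (P : Set S.Clause) (F : S.Conj) (X Y : Set S.Var) : Prop :=
  IsSplit F X Y ∧ ∀ σ : S.Assignment, ∃ τ : S.Assignment, AgreeOn X σ τ ∧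
    F.Holds (leastModel P) τ

/-! ### The transformation rules

For each rule, the data of one application and its applicability conditions. The arguments
`P₀`, `P`, `Ds` are the initial set of clauses, the current set, and the definitions introduced
so far. As clauses may be freely renamed, a rule acts on a variant `C` of a clause `C₀` in `P`. -/

/-- Conditions on `newp(X₁,…,X_k) ← c, A₁,…,A_m` for extending `P 0, …, P i` by this definition.
The level of `newp` is the maximum of the levels of the `A_j` (`0` if `m = 0`). -/
def DefinitionApplicable (ℓ : S.Pred → ℕ) (P : ℕ → Set S.Clause) (i : ℕ) (D : S.Clause) : Prop :=
  ∃ K : S.Atom, D.head = some K ∧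
    (∀ j ≤ i, ¬ OccursIn K.pred (P j)) ∧
    (∀ A ∈ D.body, OccursIn A.pred (P 0)) ∧
    (∀ k, ∃ n, K.args k = .var _ n ∧ (S.predArg K.pred k, n) ∈ D.con.vars ∪ D.body.vars) ∧
    ℓ K.pred = (D.body.map fun A => ℓ A.pred).sup

/-- Unfolding of `C : H ← c, A, G`. For each clause `D` in `P₀`, `var D` is the variant of `D`,
with no variable in common with `C`, that is used for unfolding, and `mgu D` is the chosen
most general unifier. -/
structure Unfolding (S : Signature) where
  C₀ : S.Clause
  H : Option S.Atom
  c : S.Constraint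
  A : S.Atom
  G : S.Conj
  var : S.Clause → S.Clause
  mgu : S.Clause → S.Subst

namespace Unfolding

def C (u : S.Unfolding) : S.Clause := ⟨u.H, u.c, u.A ::ₘ u.G⟩

def Applicable (u : S.Unfolding) (P₀ P : Set S.Clause) : Prop :=
  u.C₀ ∈ P ∧ u.C.IsVariant u.C₀ ∧
    (∀ D ∈ P₀, (u.var D).IsVariant D ∧ Disjoint u.C.vars (u.var D).vars) ∧
    (∀ D ∈ P₀, ∀ K ∈ (u.var D).head, (∃ θ, Atom.IsMGU θ u.A K) → Atom.IsMGU (u.mgu D) u.A K)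

/-- The set of the clauses derived by unfolding. -/
def unf (u : S.Unfolding) (P₀ : Set S.Clause) : Set S.Clause :=
  {E | ∃ D ∈ P₀, ∃ K ∈ (u.var D).head, Atom.IsMGU (u.mgu D) u.A K ∧
    ((u.c.and (u.var D).con).subst (u.mgu D)).Satisfiable ∧
    E = Clause.subst (u.mgu D) ⟨u.H, u.c.and (u.var D).con, u.G + (u.var D).body⟩}

def result (u : S.Unfolding) (P₀ P : Set S.Clause) : Set S.Clause := (P \ {u.C₀}) ∪ u.unf P₀

end Unfolding

/-- Folding of `C : H ← c, G, Q` using `D : K ← d, B` and the substitution `θ`. -/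
structure Folding (S : Signature) where
  C₀ : S.Clause
  H : Option S.Atom
  c : S.Constraint
  G : S.Conj
  Q : S.Conj
  K : S.Atom
  d : S.Constraint
  B : S.Conj
  θ : S.Subst

namespace Folding

def C (f : S.Folding) : S.Clause := ⟨f.H, f.c, f.G + f.Q⟩

def D (f : S.Folding) : S.Clause := ⟨some f.K, f.d, f.B⟩

def E (f : S.Folding) : S.Clause := ⟨f.H, f.c, f.K.subst f.θ ::ₘ f.G⟩

def Applicable (f : S.Folding) (ℓ : S.Pred → ℕ) (P Ds : Set S.Clause) : Prop :=
  f.C₀ ∈ P ∧ f.C.IsVariant f.C₀ ∧ (∃ D₀ ∈ Ds, f.D.IsVariant D₀) ∧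
    (∀ A ∈ f.H, ℓ f.K.pred ≤ ℓ A.pred) ∧
    f.Q = f.B.subst f.θ ∧ f.c.Entails (f.d.subst f.θ)

def result (f : S.Folding) (P : Set S.Clause) : Set S.Clause := (P \ {f.C₀}) ∪ {f.E}

/-- Condition (E): every variable of `(d, B)` not occurring in `K` is mapped by `θ` to a variable
that occurs neither in `H, c, G` nor in the image of any other variable of `(d, B)`. -/
def CondE (f : S.Folding) : Prop :=
  ∀ x ∈ (f.d.vars ∪ f.B.vars) \ f.K.vars, ∃ n, f.θ x.1 x.2 = .var x.1 n ∧
    (x.1, n) ∉ headVars f.H ∪ f.c.vars ∪ f.G.vars ∧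
    ∀ y ∈ f.d.vars ∪ f.B.vars, y ≠ x → (x.1, n) ∉ (f.θ y.1 y.2).vars

end Folding

/-- Deletion of a clause `C`. -/
def DeletionApplicable (P : Set S.Clause) (C : S.Clause) : Prop := C ∈ P ∧ ¬ C.con.Satisfiable

/-- Functionality rule on `C : H ← c, G, F(X,Y), F(X,Z)`, where `F(X,Z)` is obtained by replacing
the tuple `Y` of distinct variables by the tuple `Z = ζ(Y)`. -/
structure Functionality (S : Signature) where
  C₀ : S.Clause
  H : Option S.Atom
  c : S.Constraint
  G : S.Conj
  F : S.Conj
  X : Set S.Var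
  Y : List S.Var
  ζ : S.Ty → ℕ → ℕ

namespace Functionality

def C (f : S.Functionality) : S.Clause :=
  ⟨f.H, f.c, f.G + (f.F + f.F.subst (varSubst f.ζ))⟩

/-- The constraint `Y = Z, c`. -/
def eqs (f : S.Functionality) : S.Constraint :=
  f.Y.foldr (fun y c => (Constraint.eq (.var y.1 y.2) (.var y.1 (f.ζ y.1 y.2))).and c) f.c

def D (f : S.Functionality) : S.Clause := ⟨f.H, f.eqs, f.G + f.F⟩

def Applicable (f : S.Functionality) (P₀ P Ds : Set S.Clause) : Prop :=
  f.C₀ ∈ P ∧ f.C.IsVariant f.C₀ ∧ f.Y.Nodup ∧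
    (∀ v ∈ f.X, f.ζ v.1 v.2 = v.2) ∧
    (∀ v ∈ f.Y, ∀ w ∈ f.Y, (v.1, f.ζ v.1 v.2) = (w.1, f.ζ w.1 w.2) → v = w) ∧
    (∀ v ∈ f.Y, (v.1, f.ζ v.1 v.2) ∉ f.X) ∧
    Functional (definite P₀ ∪ Ds) f.F f.X {v | v ∈ f.Y}

def result (f : S.Functionality) (P : Set S.Clause) : Set S.Clause := (P \ {f.C₀}) ∪ {f.D}

end Functionality

/-- Totality rule on `C : H ← c, G, F(X,Y)`. -/
structure Totality (S : Signature) where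
  C₀ : S.Clause
  H : Option S.Atom
  c : S.Constraint
  G : S.Conj
  F : S.Conj
  X : Set S.Var
  Y : Set S.Var

namespace Totality

def C (t : S.Totality) : S.Clause := ⟨t.H, t.c, t.G + t.F⟩

def D (t : S.Totality) : S.Clause := ⟨t.H, t.c, t.G⟩

def Applicable (t : S.Totality) (P₀ P Ds : Set S.Clause) : Prop :=
  t.C₀ ∈ P ∧ t.C.IsVariant t.C₀ ∧ Disjoint t.Y t.D.vars ∧
    Total (definite P₀ ∪ Ds) t.F t.X t.Y

def result (t : S.Totality) (P : Set S.Clause) : Set S.Clause := (P \ {t.C₀}) ∪ {t.D}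

end Totality

/-- Differential replacement in `C : H ← c, G, F(X;Y)` using the variant
`D : diff(Z) ← d, F(X;Y), R(V;W)` of a definition; `K` is the atom `diff(Z)`. -/
structure DiffReplacement (S : Signature) where
  C₀ : S.Clause
  H : Option S.Atom
  c : S.Constraint
  G : S.Conj
  F : S.Conj
  X : Set S.Var
  Y : Set S.Var
  K : S.Atom
  d : S.Constraint
  R : S.Conj
  V : Set S.Var
  W : Set S.Var

namespace DiffReplacement

def C (r : S.DiffReplacement) : S.Clause := ⟨r.H, r.c, r.G + r.F⟩

def D (r : S.DiffReplacement) : S.Clause := ⟨some r.K, r.d, r.F + r.R⟩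

def E (r : S.DiffReplacement) : S.Clause := ⟨r.H, r.c, r.K ::ₘ (r.G + r.R)⟩

def Applicable (r : S.DiffReplacement) (ℓ : S.Pred → ℕ) (P₀ P Ds : Set S.Clause) : Prop :=
  r.C₀ ∈ P ∧ r.C.IsVariant r.C₀ ∧ (∃ D₀ ∈ Ds, r.D.IsVariant D₀) ∧
    (Functional (definite P₀ ∪ Ds) r.F r.X r.Y ∧ Total (definite P₀ ∪ Ds) r.F r.X r.Y) ∧
    (Functional (definite P₀ ∪ Ds) r.R r.V r.W ∧ Total (definite P₀ ∪ Ds) r.R r.V r.W) ∧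
    Disjoint r.W r.C.vars ∧
    r.c.Entails r.d ∧
    (∀ A ∈ r.H, ℓ r.K.pred < ℓ A.pred)

def result (r : S.DiffReplacement) (P : Set S.Clause) : Set S.Clause := (P \ {r.C₀}) ∪ {r.E}

/-- Condition (F). The atom `diff(Z)` has the form `diff(T_b,W_b,Y_b)`, where `T_b`, `W_b`, `Y_b`
are the variables of basic type in `X ∪ V`, `W`, `Y`, and:
(F1) it is functional from `(T_b,W_b)` to `Y_b`, (F2) `Y` is disjoint from `V` and from the
variables of `d`, (F3) no ADT variable of `Y` occurs in `H, c, G`. -/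
def CondF (r : S.DiffReplacement) (P₀ Ds : Set S.Clause) : Prop :=
  r.K.vars = bvars (r.X ∪ r.V) ∪ bvars r.W ∪ bvars r.Y ∧
    Functional (definite P₀ ∪ Ds) {r.K} (bvars (r.X ∪ r.V) ∪ bvars r.W) (bvars r.Y) ∧
    Disjoint r.Y (r.V ∪ r.d.vars) ∧
    Disjoint (adtVars r.Y) (adtVars (headVars r.H ∪ r.c.vars ∪ r.G.vars))

end DiffReplacement

/-- Applications of the seven transformation rules. -/
inductive RuleApp (S : Signature)
  | definition (D : S.Clause)
  | unfolding (u : S.Unfolding)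
  | folding (f : S.Folding)
  | deletion (C : S.Clause)
  | functionality (f : S.Functionality)
  | totality (t : S.Totality)
  | diffReplacement (r : S.DiffReplacement)

/-- The definitions introduced by the first `j` rule applications. -/
def defs (r : ℕ → S.RuleApp) (j : ℕ) : Set S.Clause := {D | ∃ i < j, r i = .definition D}

/-- `P (i+1)` is derived from `P i` by the rule application `r i`. -/
def IsStep (ℓ : S.Pred → ℕ) (P : ℕ → Set S.Clause) (r : ℕ → S.RuleApp) (i : ℕ) : Prop :=
  match r i with
  | .definition D => DefinitionApplicable ℓ P i D ∧ P (i + 1) = P i ∪ {D}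
  | .unfolding u => u.Applicable (P 0) (P i) ∧ P (i + 1) = u.result (P 0) (P i)
  | .folding f => f.Applicable ℓ (P i) (defs r i) ∧ P (i + 1) = f.result (P i)
  | .deletion C => DeletionApplicable (P i) C ∧ P (i + 1) = P i \ {C}
  | .functionality f => f.Applicable (P 0) (P i) (defs r i) ∧ P (i + 1) = f.result (P i)
  | .totality t => t.Applicable (P 0) (P i) (defs r i) ∧ P (i + 1) = t.result (P i)
  | .diffReplacement d =>
      d.Applicable ℓ (P 0) (P i) (defs r i) ∧ P (i + 1) = d.result (P i)

/-- `P 0 ⇒ P 1 ⇒ … ⇒ P n` is a transformation sequence, the `i`-th step being the rule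
application `r i`, for the level mapping `ℓ` (already including the levels that are assigned to
the predicates introduced by the definition rule). -/
def IsTransformationSequence (ℓ : S.Pred → ℕ) (P : ℕ → Set S.Clause) (r : ℕ → S.RuleApp)
    (n : ℕ) : Prop :=
  (∀ C ∈ P 0, C.Stratified ℓ) ∧ ∀ i < n, IsStep ℓ P r i

end Signature

/-! A single interpretation serves for the whole sequence: the least model M of `definite (P 0) ∪
defs r n`, which includes the definitions still to come. It suffices that M is a model of `P 0` and
that each rule only yields clauses true in M.

For `P 0` only the goals need an argument. New predicates are fresh, so on the predicates of `P 0`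
the definitions do not alter the least model (`leastModel_conservative`). That part of M lies inside
every model of `P 0`, so a goal violated by M would be violated in all of them. The same
conservativity carries totality and functionality from stage `i`, where the rules assume them, to M.

Unfolding is resolution, and the functionality rule only specialises a clause. The other rules share
one pattern: given σ satisfying the body of the new clause, change σ on a few variables so that the
old body becomes true, then read the old head back at σ. Folding needs the only-if direction of
definitions, true in M since each new predicate has a single clause (`leastModel_supported`); (E)
permits resetting the existential variables. Totality resets Y. Differential replacement resets Y so
that F holds; the definition then yields diff at the new values, (F1) forces the basic part of Y to
be unchanged, and (F3) makes the ADT part invisible to H, c, G. -/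

namespace Signature

variable {S : Signature}

/-! ### Substitution and coincidence lemmas -/

/-- The assignment that gives each variable the value of its image under `θ`. -/
def Subst.evalAt (θ : S.Subst) (σ : S.Assignment) : S.Assignment := fun s n => (θ s n).eval σ

theorem AgreeOn.mono {X Y : Set S.Var} {σ τ : S.Assignment} (h : AgreeOn Y σ τ) (hXY : X ⊆ Y) :
    AgreeOn X σ τ := fun v hv => h v (hXY hv)

theorem AgreeOn.symm {X : Set S.Var} {σ τ : S.Assignment} (h : AgreeOn X σ τ) :
    AgreeOn X τ σ := fun v hv => (h v hv).symm

theorem Term.eval_subst (θ : S.Subst) (σ : S.Assignment) {s : S.Ty} (t : S.Term s) :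
    (t.subst θ).eval σ = t.eval (θ.evalAt σ) := by
  induction t with
  | var s n => rfl
  | intConst z => rfl
  | add t u iht ihu => simp [Term.subst, Term.eval, iht, ihu]
  | smul z t ih => simp [Term.subst, Term.eval, ih]
  | boolConst b => rfl
  | con k args ih => simp [Term.subst, Term.eval, ih]

theorem Term.eval_congr {σ τ : S.Assignment} {s : S.Ty} (t : S.Term s)
    (h : AgreeOn t.vars σ τ) : t.eval σ = t.eval τ := by
  induction t with
  | var s n => exact h (s, n) rfl
  | intConst z => rfl
  | add t u iht ihu =>
    simp [Term.eval, iht (h.mono Set.subset_union_left), ihu (h.mono Set.subset_union_right)]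
  | smul z t ih => simp [Term.eval, ih h]
  | boolConst b => rfl
  | con k args ih =>
    simp only [Term.eval]
    congr 1
    funext i
    exact ih i (h.mono (Set.subset_iUnion (fun i => (args i).vars) i))

theorem Constraint.holds_subst (θ : S.Subst) (σ : S.Assignment) (c : S.Constraint) :
    (c.subst θ).Holds σ ↔ c.Holds (θ.evalAt σ) := by
  induction c with
  | tru => rfl
  | eq t u => simp [Constraint.subst, Constraint.Holds, Term.eval_subst]
  | le t u => simp [Constraint.subst, Constraint.Holds, Term.eval_subst]
  | isTrue t => simp [Constraint.subst, Constraint.Holds, Term.eval_subst]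
  | not c ih => simp [Constraint.subst, Constraint.Holds, ih]
  | and c d ihc ihd => simp [Constraint.subst, Constraint.Holds, ihc, ihd]
  | or c d ihc ihd => simp [Constraint.subst, Constraint.Holds, ihc, ihd]

theorem Constraint.holds_congr {σ τ : S.Assignment} (c : S.Constraint)
    (h : AgreeOn c.vars σ τ) : c.Holds σ ↔ c.Holds τ := by
  induction c with
  | tru => rfl
  | eq t u =>
    simp [Constraint.Holds, t.eval_congr (h.mono Set.subset_union_left),
      u.eval_congr (h.mono Set.subset_union_right)]
  | le t u =>
    simp [Constraint.Holds, t.eval_congr (h.mono Set.subset_union_left),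
      u.eval_congr (h.mono Set.subset_union_right)]
  | isTrue t => simp [Constraint.Holds, t.eval_congr h]
  | not c ih => simp [Constraint.Holds, ih h]
  | and c d ihc ihd =>
    simp [Constraint.Holds, ihc (h.mono Set.subset_union_left),
      ihd (h.mono Set.subset_union_right)]
  | or c d ihc ihd =>
    simp [Constraint.Holds, ihc (h.mono Set.subset_union_left),
      ihd (h.mono Set.subset_union_right)]

theorem Atom.holds_subst (I : S.Interp) (θ : S.Subst) (σ : S.Assignment) (A : S.Atom) :
    (A.subst θ).Holds I σ ↔ A.Holds I (θ.evalAt σ) := by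
  simp only [Atom.Holds, Atom.subst, Term.eval_subst]

theorem Atom.holds_congr (I : S.Interp) {σ τ : S.Assignment} (A : S.Atom)
    (h : AgreeOn A.vars σ τ) : A.Holds I σ ↔ A.Holds I τ := by
  have : (fun i => (A.args i).eval σ) = fun i => (A.args i).eval τ :=
    funext fun i => (A.args i).eval_congr
      (h.mono (Set.subset_iUnion (fun i => (A.args i).vars) i))
  simp only [Atom.Holds, this]

theorem Conj.vars_subset {F : S.Conj} {A : S.Atom} (hA : A ∈ F) : A.vars ⊆ Conj.vars F :=
  fun _ hv => ⟨A, hA, hv⟩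

theorem Conj.holds_subst (I : S.Interp) (θ : S.Subst) (σ : S.Assignment) (F : S.Conj) :
    (Conj.subst θ F).Holds I σ ↔ F.Holds I (θ.evalAt σ) := by
  simp only [Conj.Holds, Conj.subst, Multiset.forall_mem_map_iff, Atom.holds_subst]

theorem Conj.holds_congr (I : S.Interp) {σ τ : S.Assignment} (F : S.Conj)
    (h : AgreeOn F.vars σ τ) : F.Holds I σ ↔ F.Holds I τ :=
  forall₂_congr fun A hA => A.holds_congr I (h.mono (Conj.vars_subset hA))

theorem Conj.holds_add (I : S.Interp) (σ : S.Assignment) (F G : S.Conj) :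
    Conj.Holds I σ (F + G) ↔ F.Holds I σ ∧ G.Holds I σ := by
  simp only [Conj.Holds, Multiset.mem_add, or_imp, forall_and]

theorem Conj.holds_cons (I : S.Interp) (σ : S.Assignment) (A : S.Atom) (G : S.Conj) :
    Conj.Holds I σ (A ::ₘ G) ↔ A.Holds I σ ∧ G.Holds I σ := by
  simp [Conj.Holds]

theorem Conj.holds_mono {I J : S.Interp} (h : ∀ p a, I p a → J p a) {σ : S.Assignment}
    {F : S.Conj} (hF : F.Holds I σ) : F.Holds J σ := fun A hA => h _ _ (hF A hA)

/-- A conjunction has the same truth value in interpretations agreeing on its predicates. -/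
theorem Conj.holds_congr_interp {I J : S.Interp} {F : S.Conj}
    (h : ∀ A ∈ F, ∀ a, I A.pred a ↔ J A.pred a) (σ : S.Assignment) :
    F.Holds I σ ↔ F.Holds J σ :=
  forall₂_congr fun A hA => h A hA _

theorem head_holds_congr (I : S.Interp) {σ τ : S.Assignment} (H : Option S.Atom)
    (h : AgreeOn (headVars H) σ τ) : (∃ A ∈ H, A.Holds I σ) → ∃ A ∈ H, A.Holds I τ := by
  rintro ⟨A, hA, hσ⟩
  exact ⟨A, hA, (A.holds_congr I (h.mono fun v hv => ⟨A, hA, hv⟩)).1 hσ⟩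

theorem Clause.IsTrueIn.subst {I : S.Interp} {C : S.Clause} (h : C.IsTrueIn I) (θ : S.Subst) :
    (C.subst θ).IsTrueIn I := by
  intro σ hc hB
  obtain ⟨A, hA, hh⟩ :=
    h _ ((C.con.holds_subst θ σ).1 hc) ((Conj.holds_subst I θ σ C.body).1 hB)
  exact ⟨A.subst θ, Option.mem_map_of_mem _ hA, (Atom.holds_subst I θ σ A).2 hh⟩

theorem Clause.IsVariant.isTrueIn {I : S.Interp} {C D : S.Clause} (h : C.IsVariant D)
    (hD : D.IsTrueIn I) : C.IsTrueIn I := by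
  obtain ⟨ρ, rfl⟩ := h
  exact hD.subst _

theorem Clause.Occurs.of_isVariant {p : S.Pred} {C D : S.Clause} (h : C.IsVariant D)
    (hp : C.Occurs p) : D.Occurs p := by
  obtain ⟨ρ, rfl⟩ := h
  rcases hp with ⟨A, hA, rfl⟩ | ⟨A, hA, rfl⟩
  · obtain ⟨B, hB, rfl⟩ := Option.mem_map.1 hA
    exact .inl ⟨B, hB, rfl⟩
  · obtain ⟨B, hB, rfl⟩ := Multiset.mem_map.1 hA
    exact .inr ⟨B, hB, rfl⟩

/-! ### Least models -/

theorem isModel_leastModel {Q : Set S.Clause} (hQ : ∀ C ∈ Q, C.head ≠ none) :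
    IsModel (leastModel Q) Q := by
  intro C hC σ hc hB
  obtain ⟨A, hA⟩ := Option.ne_none_iff_exists'.1 (hQ C hC)
  refine ⟨A, hA, fun I hI => ?_⟩
  obtain ⟨A', hA', h⟩ := hI C hC σ hc (Conj.holds_mono (fun p a h => h I hI) hB)
  obtain rfl : A = A' := Option.some_injective _ (hA.symm.trans hA')
  exact h

/-- Every ground atom of the least model is the head of a ground instance of a clause whose
body is true in the least model. -/
theorem leastModel_supported {Q : Set S.Clause} (hQ : ∀ C ∈ Q, C.head ≠ none) {p : S.Pred}
    {a : (i : Fin (S.predArity p)) → S.Val (S.predArg p i)} (h : leastModel Q p a) :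
    ∃ C ∈ Q, ∃ A ∈ C.head, ∃ τ : S.Assignment, C.con.Holds τ ∧
      C.body.Holds (leastModel Q) τ ∧
      (⟨A.pred, fun i => (A.args i).eval τ⟩ :
        Σ q : S.Pred, (i : Fin (S.predArity q)) → S.Val (S.predArg q i)) = ⟨p, a⟩ := by
  -- The supported atoms of the least model again form a model of Q, so by minimality they are all
  -- of it.
  let I : S.Interp := fun q b => leastModel Q q b ∧ ∃ C ∈ Q, ∃ A ∈ C.head,
    ∃ τ : S.Assignment, C.con.Holds τ ∧ C.body.Holds (leastModel Q) τ ∧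
      (⟨A.pred, fun i => (A.args i).eval τ⟩ :
        Σ q : S.Pred, (i : Fin (S.predArity q)) → S.Val (S.predArg q i)) = ⟨q, b⟩
  refine (h I fun C hC σ hc hB => ?_).2
  have hB' : C.body.Holds (leastModel Q) σ := Conj.holds_mono (fun _ _ h => h.1) hB
  obtain ⟨A, hA, hh⟩ := isModel_leastModel hQ C hC σ hc hB'
  exact ⟨A, hA, hh, C, hC, A, hA, σ, hc, hB', rfl⟩

/-- Adding clauses whose head predicates do not occur in `Q` does not change the least model on
the other predicates. -/
theorem leastModel_conservative {Q Q' : Set S.Clause} (hsub : Q ⊆ Q') {N : Set S.Pred}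
    (hnew : ∀ C ∈ Q', C ∉ Q → ∃ A ∈ C.head, A.pred ∈ N)
    (hold : ∀ C ∈ Q, ∀ p ∈ N, ¬ C.Occurs p) {p : S.Pred} (hp : p ∉ N)
    (a : (i : Fin (S.predArity p)) → S.Val (S.predArg p i)) :
    leastModel Q p a ↔ leastModel Q' p a := by
  refine ⟨fun h I hI => h I fun C hC => hI C (hsub hC), fun h I hI => ?_⟩
  -- Any model of Q becomes a model of Q' once every predicate of N is made true everywhere: the
  -- added clauses get true heads, and those of Q do not mention N.
  refine (h (fun q b => q ∈ N ∨ I q b) fun C hC σ hc hB => ?_).resolve_left hp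
  by_cases hCQ : C ∈ Q
  · obtain ⟨A, hA, hh⟩ := hI C hCQ σ hc fun A hA =>
      (hB A hA).resolve_left fun hN => hold C hCQ _ hN (.inr ⟨A, hA, rfl⟩)
    exact ⟨A, hA, .inr hh⟩
  · obtain ⟨A, hA, hN⟩ := hnew C hC hCQ
    exact ⟨A, hA, .inl hN⟩

/-! ### Rules preserving a fixed interpretation -/

/-- `I` makes true the only-if part of the definition `D`: each true instance of the head has
values of the remaining variables that make the body true. -/
def Clause.IsSupportedIn (I : S.Interp) (D : S.Clause) : Prop :=
  ∀ K ∈ D.head, ∀ σ : S.Assignment, K.Holds I σ →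
    ∃ τ : S.Assignment, AgreeOn K.vars σ τ ∧ D.con.Holds τ ∧ D.body.Holds I τ

theorem mem_term_vars_varSubst {ρ : S.Ty → ℕ → ℕ} {s : S.Ty} (t : S.Term s) {v : S.Var}
    (hv : v ∈ (t.subst (varSubst ρ)).vars) : ∃ m, v.2 = ρ v.1 m ∧ (v.1, m) ∈ t.vars := by
  induction t with
  | var s n =>
    obtain rfl : v = (s, ρ s n) := hv
    exact ⟨n, rfl, rfl⟩
  | intConst z => exact hv.elim
  | add t u iht ihu =>
    rcases hv with hv | hv
    · obtain ⟨m, h, h'⟩ := iht hv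
      exact ⟨m, h, .inl h'⟩
    · obtain ⟨m, h, h'⟩ := ihu hv
      exact ⟨m, h, .inr h'⟩
  | smul z t ih => exact ih hv
  | boolConst b => exact hv.elim
  | con k args ih =>
    obtain ⟨i, hi⟩ := Set.mem_iUnion.1 hv
    obtain ⟨m, h, h'⟩ := ih i hi
    exact ⟨m, h, Set.mem_iUnion.2 ⟨i, h'⟩⟩

/-- Bijectivity of the renaming is essential: the witness for D is transported to C along the
inverse permutation. -/
theorem Clause.IsVariant.isSupportedIn {I : S.Interp} {C D : S.Clause} (h : C.IsVariant D)
    (hD : D.IsSupportedIn I) : C.IsSupportedIn I := by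
  obtain ⟨ρ, rfl⟩ := h
  intro K hK σ hσ
  obtain ⟨K₀, hK₀, rfl⟩ := Option.mem_map.1 hK
  obtain ⟨τ, hτ, hc, hB⟩ := hD K₀ hK₀ _ ((Atom.holds_subst I _ σ K₀).1 hσ)
  have key : (varSubst fun s => ρ s).evalAt (fun s n => τ s ((ρ s).symm n)) = τ := by
    funext s n
    simp [Subst.evalAt, varSubst, Term.eval]
  refine ⟨fun s n => τ s ((ρ s).symm n), ?_, ?_, ?_⟩
  · intro v hv
    obtain ⟨i, hi⟩ := Set.mem_iUnion.1 hv
    obtain ⟨m, hm, hmv⟩ := mem_term_vars_varSubst _ hi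
    have := hτ (v.1, m) (Set.mem_iUnion.2 ⟨i, hmv⟩)
    simpa [Subst.evalAt, varSubst, Term.eval, hm] using this
  · exact (Constraint.holds_subst _ _ _).2 (key.symm ▸ hc)
  · exact (Conj.holds_subst _ _ _ _).2 (key.symm ▸ hB)

/-- Soundness of resolution: the unifier identifies A with the head K, so the truth of K, obtained
from the clause of `P₀`, supplies the missing body atom of C. -/
theorem Unfolding.isTrueIn {u : S.Unfolding} {P₀ : Set S.Clause} {I : S.Interp}
    (hvar : ∀ D ∈ P₀, (u.var D).IsTrueIn I) (hC : u.C.IsTrueIn I) {E : S.Clause}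
    (hE : E ∈ u.unf P₀) : E.IsTrueIn I := by
  obtain ⟨D, hD, K, hK, hmgu, -, rfl⟩ := hE
  refine fun σ hc hB => ?_
  have hc' := (Constraint.holds_subst _ _ _).1 hc
  obtain ⟨hG, hB'⟩ := (Conj.holds_add _ _ _ _).1 ((Conj.holds_subst _ _ _ _).1 hB)
  obtain ⟨K', hK', hKh⟩ := hvar D hD _ hc'.2 hB'
  obtain rfl : K = K' := Option.mem_unique hK hK'
  have hA : u.A.Holds I ((u.mgu D).evalAt σ) := by
    rw [← Atom.holds_subst, hmgu.1, Atom.holds_subst]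
    exact hKh
  obtain ⟨A, hA, hh⟩ := hC _ hc'.1 ((Conj.holds_cons _ _ _ _).2 ⟨hA, hG⟩)
  exact ⟨A.subst _, Option.mem_map_of_mem _ hA, (Atom.holds_subst _ _ _ _).2 hh⟩

-- The true atom Kθ provides, through the only-if part of D, values τ for the existential variables
-- of D that make B true. By (E) these variables have distinct fresh images under θ, so σ can be
-- overwritten there with τ without disturbing H, c, G or Kθ.
open Classical in
theorem Folding.isTrueIn {f : S.Folding} {I : S.Interp} (hD : f.D.IsSupportedIn I)
    (hQ : f.Q = f.B.subst f.θ) (hE : f.CondE) (hC : f.C.IsTrueIn I) : f.E.IsTrueIn I := by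
  intro σ hc hB
  obtain ⟨hK, hG⟩ := (Conj.holds_cons _ _ _ _).1 hB
  obtain ⟨τ, hτ, -, hBτ⟩ := hD f.K rfl _ ((Atom.holds_subst _ _ _ _).1 hK)
  set L := (f.d.vars ∪ f.B.vars) \ f.K.vars
  -- A variable that is the image under θ of some x in L receives the value of x in τ; all others
  -- keep their value.
  let σ' : S.Assignment := fun s m =>
    if h : ∃ k, (s, k) ∈ L ∧ f.θ s k = .var s m then τ s h.choose else σ s m
  have hnew : ∀ v : S.Var, (∀ k, (v.1, k) ∈ L → f.θ v.1 k ≠ .var v.1 v.2) →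
      σ v.1 v.2 = σ' v.1 v.2 := by
    intro v hv
    have : ¬ ∃ k, (v.1, k) ∈ L ∧ f.θ v.1 k = .var v.1 v.2 := fun ⟨k, h, h'⟩ => hv k h h'
    simp only [σ', dif_neg this]
  have hout : AgreeOn (headVars f.H ∪ f.c.vars ∪ f.G.vars) σ σ' := by
    intro v hv
    refine hnew v fun k hk hθ => ?_
    obtain ⟨n, hn, hn', -⟩ := hE _ hk
    obtain rfl : v.2 = n := by
      have := hθ.symm.trans hn
      injection this
    exact hn' hv
  have hin : AgreeOn (f.d.vars ∪ f.B.vars) (f.θ.evalAt σ') τ := by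
    intro y hy
    by_cases hyK : y ∈ f.K.vars
    · rw [← hτ y hyK]
      refine (Term.eval_congr _ fun v hv => hnew v fun k hk hθ => ?_).symm
      obtain ⟨n, hn, -, hn'⟩ := hE _ hk
      obtain rfl : v.2 = n := by
        have := hθ.symm.trans hn
        injection this
      exact hn' y hy (fun h => hk.2 (h ▸ hyK)) hv
    · obtain ⟨s, k⟩ := y
      obtain ⟨n, hn, -, hn'⟩ := hE (s, k) ⟨hy, hyK⟩
      have hex : ∃ k, (s, k) ∈ L ∧ f.θ s k = .var s n := ⟨k, ⟨hy, hyK⟩, hn⟩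
      -- The preimage is unique, since (E) forbids the image of one variable of L to occur in that
      -- of another.
      have hk : hex.choose = k := by
        by_contra hne
        refine hn' (s, hex.choose) hex.choose_spec.1.1 (fun h => hne (congrArg Prod.snd h)) ?_
        rw [hex.choose_spec.2]
        rfl
      change (f.θ s k).eval σ' = τ s k
      rw [show f.θ s k = .var s n from hn]
      change σ' s n = τ s k
      simp only [σ', dif_pos hex, hk]
  have hBσ' : f.Q.Holds I σ' := by
    rw [hQ, Conj.holds_subst]
    exact (Conj.holds_congr I f.B (hin.mono Set.subset_union_right)).2 hBτ
  refine head_holds_congr I f.H (hout.symm.mono fun v hv => .inl (.inl hv)) (hC σ' ?_ ?_)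
  · exact (Constraint.holds_congr f.c (hout.mono fun v hv => .inl (.inr hv))).1 hc
  · exact (Conj.holds_add _ _ _ _).2
      ⟨(Conj.holds_congr I f.G (hout.mono fun v hv => .inr hv)).1 hG, hBσ'⟩

theorem Functionality.holds_eqs {f : S.Functionality} {σ : S.Assignment} (h : f.eqs.Holds σ) :
    f.c.Holds σ ∧ ∀ y ∈ f.Y, σ y.1 y.2 = σ y.1 (f.ζ y.1 y.2) := by
  unfold Functionality.eqs at h
  generalize f.Y = Y at h ⊢
  induction Y with
  | nil => exact ⟨h, by simp⟩
  | cons y Y ih =>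
    obtain ⟨h₁, h₂⟩ := h
    refine ⟨(ih h₂).1, fun z hz => ?_⟩
    rcases List.mem_cons.1 hz with rfl | hz
    · exact h₁
    · exact (ih h₂).2 z hz

/-- Under the equations Y = Z the conjunctions F(X,Y) and F(X,Z) have the same truth value, so the
new body implies the old one. -/
theorem Functionality.isTrueIn {f : S.Functionality} {I : S.Interp}
    (hX : ∀ v ∈ f.X, f.ζ v.1 v.2 = v.2) (hF : f.F.vars ⊆ f.X ∪ {v | v ∈ f.Y})
    (hC : f.C.IsTrueIn I) : f.D.IsTrueIn I := by
  intro σ hc hB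
  obtain ⟨hc, hY⟩ := Functionality.holds_eqs hc
  obtain ⟨hG, hFσ⟩ := (Conj.holds_add _ _ _ _).1 hB
  refine hC σ hc ((Conj.holds_add _ _ _ _).2 ⟨hG, (Conj.holds_add _ _ _ _).2 ⟨hFσ, ?_⟩⟩)
  refine (Conj.holds_subst _ _ _ _).2 ((Conj.holds_congr I f.F fun v hv => ?_).1 hFσ)
  change σ v.1 v.2 = σ v.1 (f.ζ v.1 v.2)
  rcases hF hv with h | h
  · rw [hX v h]
  · exact hY v h

open Classical in
/-- `F(X,Y)` being total, the values of `Y` can be changed so as to make `F` true. -/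
theorem exists_agreeOn_compl_of_total {I : S.Interp} {F : S.Conj} {X Y : Set S.Var}
    (hFv : F.vars = X ∪ Y)
    (hF : ∀ σ : S.Assignment, ∃ τ : S.Assignment, AgreeOn X σ τ ∧ F.Holds I τ)
    (σ : S.Assignment) : ∃ σ' : S.Assignment, AgreeOn Yᶜ σ σ' ∧ F.Holds I σ' := by
  obtain ⟨τ, hτ, hFτ⟩ := hF σ
  refine ⟨fun s n => if (s, n) ∈ Y then τ s n else σ s n, fun v hv => ?_, ?_⟩
  · exact (if_neg hv).symm
  · refine (Conj.holds_congr I F fun v hv => ?_).1 hFτ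
    by_cases h : v ∈ Y
    · exact (if_pos h).symm
    · rw [hFv] at hv
      exact ((if_neg h).trans (hτ v (hv.resolve_right h))).symm

theorem Totality.isTrueIn {t : S.Totality} {I : S.Interp} (hFv : t.F.vars = t.X ∪ t.Y)
    (hF : ∀ σ : S.Assignment, ∃ τ : S.Assignment, AgreeOn t.X σ τ ∧ t.F.Holds I τ)
    (hY : Disjoint t.Y t.D.vars) (hC : t.C.IsTrueIn I) : t.D.IsTrueIn I := by
  intro σ hc hB
  obtain ⟨σ', hσ', hFnew⟩ := exists_agreeOn_compl_of_total hFv hF σ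
  have hag : AgreeOn t.D.vars σ σ' := hσ'.mono hY.subset_compl_left
  refine head_holds_congr I t.H (hag.symm.mono fun v hv => .inl (.inl hv)) (hC σ' ?_ ?_)
  · exact (Constraint.holds_congr t.c (hag.mono fun v hv => .inl (.inr hv))).1 hc
  · exact (Conj.holds_add _ _ _ _).2
      ⟨(Conj.holds_congr I t.G (hag.mono fun v hv => .inr hv)).1 hB, hFnew⟩

/-- Here σ' is σ with Y reset so that F holds. Then diff is true both at σ, by the new body, and at
σ', by the definition; functionality compares the two, so that σ and σ' agree on everything H, c, G
can see. -/
theorem DiffReplacement.isTrueIn {r : S.DiffReplacement} {I : S.Interp}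
    (hD : r.D.IsTrueIn I) (hFv : r.F.vars = r.X ∪ r.Y) (hXY : Disjoint r.X r.Y)
    (hF : ∀ σ : S.Assignment, ∃ τ : S.Assignment, AgreeOn r.X σ τ ∧ r.F.Holds I τ)
    (hRv : r.R.vars = r.V ∪ r.W) (hW : Disjoint r.W r.C.vars) (hcd : r.c.Entails r.d)
    (hK : ∀ σ τ : S.Assignment, AgreeOn (bvars (r.X ∪ r.V) ∪ bvars r.W) σ τ →
      r.K.Holds I σ → r.K.Holds I τ → AgreeOn (bvars r.Y) σ τ)
    (hY : Disjoint r.Y (r.V ∪ r.d.vars))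
    (hadt : Disjoint (adtVars r.Y) (adtVars (headVars r.H ∪ r.c.vars ∪ r.G.vars)))
    (hC : r.C.IsTrueIn I) : r.E.IsTrueIn I := by
  intro σ hc hB
  obtain ⟨hKσ, hB⟩ := (Conj.holds_cons _ _ _ _).1 hB
  obtain ⟨hG, hR⟩ := (Conj.holds_add _ _ _ _).1 hB
  obtain ⟨σ', hσ', hFnew⟩ := exists_agreeOn_compl_of_total hFv hF σ
  have hX' : AgreeOn r.X σ σ' := hσ'.mono hXY.subset_compl_right
  have hVd : AgreeOn (r.V ∪ r.d.vars) σ σ' := hσ'.mono hY.subset_compl_left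
  have hYC : r.Y ⊆ r.C.vars := by
    intro v hv
    obtain ⟨A, hA, hvA⟩ : v ∈ r.F.vars := hFv ▸ Or.inr hv
    exact .inr ⟨A, Multiset.mem_add.2 (.inr hA), hvA⟩
  -- F is part of C, so Y consists of variables of C, which W avoids.
  have hW' : AgreeOn r.W σ σ' := hσ'.mono (hW.mono_right hYC).subset_compl_right
  have hRσ' : r.R.Holds I σ' := by
    refine (Conj.holds_congr I r.R fun v hv => ?_).1 hR
    rw [hRv] at hv
    exact hv.elim (fun h => hVd v (.inl h)) (hW' v)
  -- The entailment c → d is applied at σ, since c is not yet known at σ'; d then passes to σ'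
  -- because Y avoids its variables.
  have hdσ' : r.d.Holds σ' :=
    (Constraint.holds_congr r.d (hVd.mono Set.subset_union_right)).1 (hcd σ hc)
  obtain ⟨K, hK', hKσ'⟩ := hD σ' hdσ' ((Conj.holds_add _ _ _ _).2 ⟨hFnew, hRσ'⟩)
  obtain rfl : r.K = K := Option.some_injective _ hK'
  have hYb : AgreeOn (bvars r.Y) σ σ' := by
    refine hK σ σ' (fun v hv => ?_) hKσ hKσ'
    rcases hv with ⟨h | h, -⟩ | ⟨h, -⟩
    · exact hX' v h
    · exact hVd v (.inl h)
    · exact hW' v h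
  have hag : AgreeOn (headVars r.H ∪ r.c.vars ∪ r.G.vars) σ σ' := by
    intro v hv
    by_cases hvY : v ∈ r.Y
    · by_cases hb : v.1.IsBasic
      · exact hYb v ⟨hvY, hb⟩
      · exact (Set.disjoint_left.1 hadt ⟨hvY, hb⟩ ⟨hv, hb⟩).elim
    · exact hσ' v hvY
  refine head_holds_congr I r.H (hag.symm.mono fun v hv => .inl (.inl hv)) (hC σ' ?_ ?_)
  · exact (Constraint.holds_congr r.c (hag.mono fun v hv => .inl (.inr hv))).1 hc
  · exact (Conj.holds_add _ _ _ _).2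
      ⟨(Conj.holds_congr I r.G (hag.mono fun v hv => .inr hv)).1 hG, hFnew⟩

/-! ### Transformation sequences -/

/-- The predicates introduced by the definition rule from the `i`-th step to the `n`-th. -/
def newPreds (r : ℕ → S.RuleApp) (i n : ℕ) : Set S.Pred :=
  {p | ∃ j, i ≤ j ∧ j < n ∧ ∃ D, r j = .definition D ∧ ∃ K ∈ D.head, K.pred = p}

section Sequence

variable {ℓ : S.Pred → ℕ} {P : ℕ → Set S.Clause} {r : ℕ → S.RuleApp} {n : ℕ}

theorem IsTransformationSequence.definition_step (h : IsTransformationSequence ℓ P r n) {i : ℕ}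
    (hi : i < n) {D : S.Clause} (hD : r i = .definition D) :
    DefinitionApplicable ℓ P i D ∧ P (i + 1) = P i ∪ {D} := by
  have := h.2 i hi
  simpa only [IsStep, hD] using this

theorem IsTransformationSequence.not_occursIn (h : IsTransformationSequence ℓ P r n) {i k : ℕ}
    (hik : k ≤ i) {p : S.Pred} (hp : p ∈ newPreds r i n) : ¬ OccursIn p (P k) := by
  obtain ⟨j, hij, hjn, D, hD, K, hK, rfl⟩ := hp
  obtain ⟨⟨K', hK', hocc, -⟩, -⟩ := h.definition_step hjn hD
  obtain rfl : K = K' := Option.mem_unique hK hK'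
  exact hocc k (hik.trans hij)

theorem IsTransformationSequence.head_ne_none (h : IsTransformationSequence ℓ P r n) {i : ℕ}
    (hi : i ≤ n) {C : S.Clause} (hC : C ∈ definite (P 0) ∪ defs r i) : C.head ≠ none := by
  rcases hC with hC | ⟨j, hj, hC⟩
  · exact hC.2
  · obtain ⟨⟨K, hK, -⟩, -⟩ := h.definition_step (hj.trans_le hi) hC
    simp [hK]

/-- Moves the semantic side conditions of step `i` to the final least model. -/
theorem IsTransformationSequence.leastModel_iff (h : IsTransformationSequence ℓ P r n) {i : ℕ}
    (hi : i ≤ n) {p : S.Pred} (hp : p ∉ newPreds r i n)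
    (a : (k : Fin (S.predArity p)) → S.Val (S.predArg p k)) :
    leastModel (definite (P 0) ∪ defs r i) p a ↔
      leastModel (definite (P 0) ∪ defs r n) p a := by
  refine leastModel_conservative ?_ ?_ ?_ hp a
  · exact Set.union_subset_union_right _ fun D ⟨j, hj, hD⟩ => ⟨j, hj.trans_le hi, hD⟩
  · rintro C hC hC'
    obtain ⟨j, hj, hD⟩ := hC.resolve_left fun h' => hC' (.inl h')
    have hij : i ≤ j := not_lt.1 fun hlt => hC' (.inr ⟨j, hlt, hD⟩)
    obtain ⟨⟨K, hK, -⟩, -⟩ := h.definition_step hj hD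
    exact ⟨K, hK, j, hij, hj, C, hD, K, hK, rfl⟩
  · rintro C (hC | ⟨j, hj, hD⟩) p hp hocc
    -- Predicates introduced from step `i` on are absent from `P 0` and, below, from `P (j + 1)`
    -- with `j + 1 ≤ i`, which contains the definition introduced at step `j`.
    · exact h.not_occursIn (Nat.zero_le i) hp ⟨C, hC.1, hocc⟩
    · refine h.not_occursIn (Nat.succ_le_of_lt hj) hp ⟨C, ?_, hocc⟩
      rw [(h.definition_step (hj.trans_le hi) hD).2]
      exact .inr rfl

/-- A predicate introduced by the definition rule has a single clause. -/
theorem IsTransformationSequence.eq_of_head_pred (h : IsTransformationSequence ℓ P r n)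
    {C D : S.Clause} (hD : D ∈ defs r n) (hC : C ∈ definite (P 0) ∪ defs r n) {A K : S.Atom}
    (hA : A ∈ C.head) (hK : K ∈ D.head) (hAK : A.pred = K.pred) : C = D := by
  obtain ⟨j, hj, hrj⟩ := hD
  have hstep : ∀ {i : ℕ} {D : S.Clause}, i < n → r i = .definition D → D ∈ P (i + 1) := by
    intro i D hi hD
    rw [(h.definition_step hi hD).2]
    exact .inr rfl
  have hKj : K.pred ∈ newPreds r j n := ⟨j, le_rfl, hj, D, hrj, K, hK, rfl⟩
  rcases hC with hC | ⟨k, hk, hrk⟩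
  · exact (h.not_occursIn (Nat.zero_le j) hKj ⟨C, hC.1, .inl ⟨A, hA, hAK⟩⟩).elim
  · rcases lt_trichotomy k j with hlt | rfl | hlt
    · exact (h.not_occursIn (Nat.succ_le_of_lt hlt) hKj
        ⟨C, hstep hk hrk, .inl ⟨A, hA, hAK⟩⟩).elim
    · exact RuleApp.definition.inj (hrk.symm.trans hrj)
    · exact (h.not_occursIn (Nat.succ_le_of_lt hlt)
        ⟨k, le_rfl, hk, C, hrk, A, hA, rfl⟩ ⟨D, hstep hj hrj, .inl ⟨K, hK, hAK.symm⟩⟩).elim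

/-- A true atom of a least model comes from some clause instance, and only D itself can have this
head predicate. As the arguments of the head are variables, equal ground atoms mean equal values of
these variables. -/
theorem IsTransformationSequence.isSupportedIn (h : IsTransformationSequence ℓ P r n)
    {D : S.Clause} (hD : D ∈ defs r n) :
    D.IsSupportedIn (leastModel (definite (P 0) ∪ defs r n)) := by
  intro K hK σ hσ
  obtain ⟨C, hC, A, hA, τ, hc, hB, heq⟩ :=
    leastModel_supported (fun C hC => h.head_ne_none le_rfl hC) hσ
  have hAK : A.pred = K.pred := congrArg Sigma.fst heq
  obtain rfl := h.eq_of_head_pred hD hC hA hK hAK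
  obtain rfl : A = K := Option.mem_unique hA hK
  refine ⟨τ, fun v hv => ?_, hc, hB⟩
  obtain ⟨j, hj, hrj⟩ := hD
  obtain ⟨⟨K', hK', -, -, hvar, -⟩, -⟩ := h.definition_step hj hrj
  obtain rfl : A = K' := Option.mem_unique hA hK'
  obtain ⟨i, hi⟩ := Set.mem_iUnion.1 hv
  obtain ⟨m, hm, -⟩ := hvar i
  rw [hm] at hi
  obtain rfl : v = (_, m) := hi
  have := congrFun (eq_of_heq (Sigma.mk.inj heq).2) i
  simp only [hm, Term.eval] at this
  exact this.symm

theorem IsTransformationSequence.isModel_zero (h : IsTransformationSequence ℓ P r n)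
    (hsat : Satisfiable (P 0)) : IsModel (leastModel (definite (P 0) ∪ defs r n)) (P 0) := by
  intro C hC
  by_cases hh : C.head = none
  -- A goal body true in M is true in the least model of `definite (P 0)`, hence in the given model
  -- I of `P 0`, which contradicts the truth of the goal in I.
  · obtain ⟨I, hI⟩ := hsat
    intro σ hc hB
    have hB' : C.body.Holds I σ := by
      intro A hA
      refine (h.leastModel_iff (Nat.zero_le n) (fun hp =>
        h.not_occursIn le_rfl hp ⟨C, hC, .inr ⟨A, hA, rfl⟩⟩) _).2 (hB A hA) I ?_
      rintro D (hD | ⟨j, hj, -⟩)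
      · exact hI D hD.1
      · exact (Nat.not_lt_zero j hj).elim
    obtain ⟨A, hA, -⟩ := hI C hC σ hc hB'
    simp [hh] at hA
  · exact isModel_leastModel (fun C hC => h.head_ne_none le_rfl hC) C (.inl ⟨hC, hh⟩)

/-- Each rule preserves the truth of the clauses in the least model of the definite clauses of
`P 0` together with all the definitions. -/
theorem IsTransformationSequence.isModel_succ (h : IsTransformationSequence ℓ P r n)
    (hE : ∀ i < n, ∀ f : S.Folding, r i = .folding f → f.CondE)
    (hF : ∀ i < n, ∀ d : S.DiffReplacement, r i = .diffReplacement d →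
      d.CondF (P 0) (defs r i))
    (hM₀ : IsModel (leastModel (definite (P 0) ∪ defs r n)) (P 0)) {i : ℕ} (hi : i < n)
    (hM : IsModel (leastModel (definite (P 0) ∪ defs r n)) (P i)) :
    IsModel (leastModel (definite (P 0) ∪ defs r n)) (P (i + 1)) := by
  have hmodel : IsModel (leastModel (definite (P 0) ∪ defs r n))
      (definite (P 0) ∪ defs r n) := isModel_leastModel fun C hC => h.head_ne_none le_rfl hC
  have hdefs : defs r i ⊆ defs r n := fun D ⟨j, hj, hD⟩ => ⟨j, hj.trans hi, hD⟩
  -- Body predicates of a clause of `P i` are not introduced later, so the two least models agree on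
  -- them.
  have htrans : ∀ {C C₀ : S.Clause}, C₀ ∈ P i → C.IsVariant C₀ → ∀ A ∈ C.body, ∀ a,
      leastModel (definite (P 0) ∪ defs r i) A.pred a ↔
        leastModel (definite (P 0) ∪ defs r n) A.pred a := by
    intro C C₀ hC₀ hvar A hA
    exact h.leastModel_iff hi.le fun hp => h.not_occursIn le_rfl hp
      ⟨C₀, hC₀, Clause.Occurs.of_isVariant hvar (.inr ⟨A, hA, rfl⟩)⟩
  have hreplace : ∀ {C₀ E : S.Clause},
      E.IsTrueIn (leastModel (definite (P 0) ∪ defs r n)) →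
      IsModel (leastModel (definite (P 0) ∪ defs r n)) ((P i \ {C₀}) ∪ {E}) := by
    rintro C₀ E hE C (hC | rfl)
    · exact hM C hC.1
    · exact hE
  have hstep := h.2 i hi
  unfold IsStep at hstep
  split at hstep
  · rename_i D hD
    rw [hstep.2]
    rintro C (hC | rfl)
    · exact hM C hC
    · exact hmodel C (.inr ⟨i, hi, hD⟩)
  · rename_i u hu
    obtain ⟨⟨hC₀, hvar, hD, -⟩, hP⟩ := hstep
    rw [hP]
    rintro C (hC | hC)
    · exact hM C hC.1
    · exact Unfolding.isTrueIn (fun D hD' => (hD D hD').1.isTrueIn (hM₀ D hD'))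
        (hvar.isTrueIn (hM _ hC₀)) hC
  · rename_i f hf
    obtain ⟨⟨hC₀, hvar, ⟨D₀, hD₀, hDvar⟩, -, hQ, -⟩, hP⟩ := hstep
    rw [hP]
    exact hreplace (Folding.isTrueIn (hDvar.isSupportedIn (h.isSupportedIn (hdefs hD₀))) hQ
      (hE i hi f hf) (hvar.isTrueIn (hM _ hC₀)))
  · rw [hstep.2]
    exact fun C hC => hM C hC.1
  · rename_i f hf
    obtain ⟨⟨hC₀, hvar, -, hX, -, -, ⟨-, -, hFv⟩, -⟩, hP⟩ := hstep
    rw [hP]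
    exact hreplace (Functionality.isTrueIn hX hFv.subset (hvar.isTrueIn (hM _ hC₀)))
  · rename_i t ht
    obtain ⟨⟨hC₀, hvar, hY, ⟨-, -, hFv⟩, htot⟩, hP⟩ := hstep
    rw [hP]
    refine hreplace (Totality.isTrueIn hFv (fun σ => ?_) hY (hvar.isTrueIn (hM _ hC₀)))
    obtain ⟨τ, hτ, hFτ⟩ := htot σ
    exact ⟨τ, hτ, (Conj.holds_congr_interp (fun A hA => htrans hC₀ hvar A
      (Multiset.mem_add.2 (.inr hA))) τ).1 hFτ⟩
  · rename_i d hd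
    obtain ⟨⟨hC₀, hvar, ⟨D₀, hD₀, hDvar⟩, ⟨-, ⟨-, hXY, hFv⟩, htot⟩, ⟨⟨⟨-, -, hRv⟩, -⟩, -⟩,
      hW, hcd, -⟩, hP⟩ := hstep
    obtain ⟨-, ⟨-, hfun⟩, hY, hadt⟩ := hF i hi d hd
    -- The predicate diff was introduced at some step `j < i`, so it already has its final meaning
    -- at stage `i`, where (F1) is stated.
    have hKM : ∀ σ, d.K.Holds (leastModel (definite (P 0) ∪ defs r n)) σ →
        Conj.Holds (leastModel (definite (P 0) ∪ defs r i)) σ {d.K} := by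
      intro σ hσ A hA
      obtain rfl := Multiset.mem_singleton.1 hA
      refine (h.leastModel_iff hi.le (fun hp => ?_) _).2 hσ
      obtain ⟨j, hj, hrj⟩ := hD₀
      refine h.not_occursIn (Nat.succ_le_of_lt hj) hp ⟨D₀, ?_,
        Clause.Occurs.of_isVariant hDvar (.inl ⟨d.K, rfl, rfl⟩)⟩
      rw [(h.definition_step (hj.trans hi) hrj).2]
      exact .inr rfl
    rw [hP]
    refine hreplace (DiffReplacement.isTrueIn (hDvar.isTrueIn (hmodel _ (.inr (hdefs hD₀))))
      hFv hXY (fun σ => ?_) hRv hW hcd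
      (fun σ τ hag hσ hτ => hfun σ τ hag (hKM σ hσ) (hKM τ hτ)) hY hadt
      (hvar.isTrueIn (hM _ hC₀)))
    obtain ⟨τ, hτ, hFτ⟩ := htot σ
    exact ⟨τ, hτ, (Conj.holds_congr_interp (fun A hA => htrans hC₀ hvar A
      (Multiset.mem_add.2 (.inr hA))) τ).1 hFτ⟩

end Sequence

end Signature

theorem theorem6 (S : Signature) (ℓ : S.Pred → ℕ) (n : ℕ) (P : ℕ → Set S.Clause)
    (r : ℕ → S.RuleApp)
    (hseq : Signature.IsTransformationSequence ℓ P r n)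
    (hE : ∀ i < n, ∀ f : S.Folding, r i = .folding f → f.CondE)
    (hF : ∀ i < n, ∀ d : S.DiffReplacement, r i = .diffReplacement d →
      d.CondF (P 0) (Signature.defs r i))
    (hsat : Signature.Satisfiable (P 0)) :
    Signature.Satisfiable (P n) := by
  have hM₀ := hseq.isModel_zero hsat
  suffices ∀ i ≤ n, Signature.IsModel
      (Signature.leastModel (Signature.definite (P 0) ∪ Signature.defs r n)) (P i) from
    ⟨_, this n le_rfl⟩
  intro i
  induction i with
  | zero => exact fun _ => hM₀
  | succ i ih => exact fun hi => hseq.isModel_succ hE hF hM₀ hi (ih (Nat.le_of_succ_le hi))
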